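/- **Setting.** Let $\mathbb K$ be an algebraically closed field of characteristic $0$ and let $p\ge 2$ be an integer. For $\alpha,\gamma\in\mathbb K^\times$ write $\alpha\sim\gamma$ if $\alpha^{p^r}=\gamma^{p^s}$ for some integers $r,s\ge 0$. The equivalence classes $\tau\subset\mathbb K^\times$ are called Mahler trees. The cycle $\mathcal C(\tau)$ is the set of $\gamma\in\tau$ that are roots of unity of order coprime to $p$, and $e:=|\mathcal C(\tau)|$. The tree $\tau$ is *non-torsion* if $\mathcal C(\tau)=\emptyset$ and *torsion* otherwise. Fix $f\in\mathbb K(x)$ and a Mahler tree $\tau$. For $\alpha\in\tau$ and $k\ge 1$ let $c_k(\alpha)$ be the coefficient of $(x-\alpha)^{-k}$ in the partial fraction decomposition of $f$; let $\mathrm{sing}(f,\tau)$ be the set of poles of $f$ in $\tau$, and $m$ the largest order of a pole of $f$ in $\tau$ (with $m=0$ if there is none). For $n\ge0$, $1\le k\le s$ and $\alpha\in\mathbb K^\times$, the Mahler coefficient $V^s_{k,n}(\alpha)\in\mathbb K$ is the coefficient of $(x-\alpha)^{-k}$ in the partial fraction decomposition of $(x^{p^n}-\alpha^{p^n})^{-s}$,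 and $\mathbb V^s_{k,n}\in\mathbb Q$ is the coefficient of $(x-1)^{s-k}$ in the Taylor expansion of $(1+x+\dots+x^{p^n-1})^{-s}$ at $x=1$. *Heights.* Suppose $\mathrm{sing}(f,\tau)\ne\emptyset$. If $\tau$ is non-torsion, let $h\ge 0$ be smallest such that there is a $\gamma\in\tau$ with the property that every $\alpha\in\mathrm{sing}(f,\tau)$ satisfies $\alpha^{p^n}=\gamma$ for some $0\le n\le h$; this $\gamma$ is unique, and the height of any $\alpha\in\tau$ with $\alpha^{p^n}=\gamma$ for some $0\le n\le h$ is this (unique) $n$ (the other elements of $\tau$ have no height). If $\tau$ is torsion, the height of $\alpha\in\tau$ is the smallest $n\ge0$ with $\alpha^{p^n}\in\mathcal C(\tau)$, and $h$ is the largest height of an element of $\mathrm{sing}(f,\tau)$. **The two families of residues.** For $k\ge1$ both $\mathrm{dres}_0(f,\tau,k)$ (the $\lambda$-Mahler discrete residue for $\lambda=0$) and $\mathrm{dres}(f,\tau,k)$ (the recursive Mahler discrete residue) are vectors indexed by $\alpha\in\tau$. Both are $\mathbf 0$ if $\mathrm{sing}(f,\tau)=\emptyset$ or $k>m$, and in all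 cases their $\alpha$-component is $0$ unless $\alpha$ has height $h$. For $1\le k\le m$ and $\alpha\in\tau$ of height $h$ the components are as follows. 1. *$\tau$ non-torsion.* First, $\mathrm{dres}_0(f,\tau,k)_\alpha=\sum_{s=k}^m\sum_{n=0}^h V^s_{k,n}(\alpha)\,c_s(\alpha^{p^n})$. Second, for $\xi$ of height $0$ put $\hat c_k(\xi)=c_k(\xi)$, and for $\xi$ of height $n$ with $1\le n\le h$ put recursively $$\hat c_k(\xi)=c_k(\xi)+\sum_{s=k}^m V^s_{k,1}(\xi)\,\hat c_s(\xi^p)\qquad(1\le k\le m);\tag{$*$}$$ then $\mathrm{dres}(f,\tau,k)_\alpha=\hat c_k(\alpha)$. 2. *$\tau$ torsion, $h=0$.* $\mathrm{dres}_0(f,\tau,k)_\alpha=c_k(\alpha)$ and $\mathrm{dres}(f,\tau,k)_\alpha=c_k(\alpha)$. 3. *$\tau$ torsion, $h\ge1$.* For $\mathrm{dres}_0$, define $d_k(\gamma)$ for $\gamma\in\mathcal C(\tau)$ by descending recursion on $k=m,m-1,\dots,1$ by $$d_k(\gamma)=\frac{\gamma^k}{p^{-ke}-1}\sum_{j=0}^{e-1}p^{-kj}\gamma^{-kp^j}\Bigl[c_k(\gamma^{p^j})-\sum_{s=k+1}^m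 V^s_{k,1}(\gamma^{p^j})\,d_s(\gamma^{p^{j+1}})\Bigr],$$ put $\tilde c_k(\gamma)=-d_k(\gamma)+\sum_{s=k}^m V^s_{k,1}(\gamma)\,d_s(\gamma^p)$, and set $$\mathrm{dres}_0(f,\tau,k)_\alpha=\sum_{s=k}^m\sum_{n=0}^{h-1}V^s_{k,n}(\alpha)\,c_s(\alpha^{p^n})-\sum_{s=k}^m\mathbb V^s_{k,h-1}\,\alpha^{k-sp^{h+e-1}}\Bigl(\tilde c_s(\alpha^{p^{h+e-1}})+d_s(\alpha^{p^{h+e-1}})\Bigr).$$ For $\mathrm{dres}$, let $(\delta_k(\gamma))_{1\le k\le m,\ \gamma\in\mathcal C(\tau)}$ be the image of $(c_k(\gamma))_{1\le k\le m,\ \gamma\in\mathcal C(\tau)}$ under the inverse of the $\mathbb K$-linear bijection $$(\delta_k(\gamma))\longmapsto\Bigl(\delta_k(\gamma)-\sum_{s=k}^m V^s_{k,1}(\gamma)\,\delta_s(\gamma^p)\Bigr);$$ put $\hat c_k(\gamma)=\delta_k(\gamma)$ for $\gamma\in\mathcal C(\tau)$ (height $0$), define $\hat c_k(\xi)$ by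 the recursion $(*)$ for $\xi\in\tau$ of height $n$ with $1\le n\le h$, and set $\mathrm{dres}(f,\tau,k)_\alpha=\hat c_k(\alpha)$. **Proposition.** For every $f\in\mathbb K(x)$, every Mahler tree $\tau$ and every $k\ge1$, $$\mathrm{dres}(f,\tau,k)=\mathrm{dres}_0(f,\tau,k).$$ -/

import Mathlib

open Polynomial

noncomputable section

namespace Mahler

variable {K : Type*} [Field K]

/-! ### Partial fractions -/

/-- `polarCoeff f α k` is the coefficient of `1 / (x - α) ^ k` (for `k ≥ 1`) in the partial fraction
decomposition of `f`, computed as the coefficient of `t ^ (-k)` in the Laurent expansion of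
`f (t + α)` at `t = 0`; see `polarCoeff_of_partialFraction`. -/
def polarCoeff (f : RatFunc K) (α : K) (k : ℕ) : K :=
  ((RatFunc.laurent α f : RatFunc K) : LaurentSeries K).coeff (-(k : ℤ))

theorem polarCoeff_add (f g : RatFunc K) (α : K) (k : ℕ) :
    polarCoeff (f + g) α k = polarCoeff f α k + polarCoeff g α k := by
  simp [polarCoeff]

theorem polarCoeff_sum {ι : Type*} (s : Finset ι) (f : ι → RatFunc K) (α : K) (k : ℕ) :
    polarCoeff (∑ i ∈ s, f i) α k = ∑ i ∈ s, polarCoeff (f i) α k := by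
  classical
  induction s using Finset.induction_on with
  | empty => simp [polarCoeff]
  | insert i s hi ih => rw [Finset.sum_insert hi, Finset.sum_insert hi, polarCoeff_add, ih]

theorem polarCoeff_polynomial (P : K[X]) (α : K) (k : ℕ) (hk : 1 ≤ k) :
    polarCoeff (algebraMap K[X] (RatFunc K) P) α k = 0 := by
  rw [polarCoeff, RatFunc.laurent_algebraMap]
  have := RatFunc.coe_coe (taylor α P)
  rw [RatFunc.coePolynomial] at this
  rw [← this, PowerSeries.coeff_coe, if_pos (by omega)]

theorem polarCoeff_simple_self (a α : K) (j k : ℕ) :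
    polarCoeff (RatFunc.C a / (RatFunc.X - RatFunc.C α) ^ j) α k = if j = k then a else 0 := by
  have h : (RatFunc.laurent α (RatFunc.C a / (RatFunc.X - RatFunc.C α) ^ j) : RatFunc K) =
      RatFunc.C a * (RatFunc.X ^ j)⁻¹ := by
    simp [div_eq_mul_inv]
  have hC : ((RatFunc.C a : RatFunc K) : LaurentSeries K) = HahnSeries.C a := by
    have := RatFunc.coe_coe (C a : K[X])
    simpa using this.symm
  rw [polarCoeff, h]
  simp only [map_mul, map_inv₀, map_pow, hC, RatFunc.coe_X]
  rw [← RatFunc.single_one_eq_pow, HahnSeries.inv_single, HahnSeries.C_apply,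
    HahnSeries.single_mul_single, HahnSeries.coeff_single]
  simp [eq_comm]

theorem polarCoeff_simple_of_ne (a α β : K) (hαβ : β ≠ α) (j k : ℕ) (hk : 1 ≤ k) :
    polarCoeff (RatFunc.C a / (RatFunc.X - RatFunc.C β) ^ j) α k = 0 := by
  have h : (RatFunc.laurent α (RatFunc.C a / (RatFunc.X - RatFunc.C β) ^ j) : RatFunc K) =
      algebraMap K[X] (RatFunc K) (C a) / algebraMap K[X] (RatFunc K) ((X + C (α - β)) ^ j) := by
    simp [add_sub_assoc]
  have hu : ((((X + C (α - β)) ^ j : K[X]) : PowerSeries K)) *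
      ((((X + C (α - β)) ^ j : K[X]) : PowerSeries K))⁻¹ = 1 := by
    apply PowerSeries.mul_inv_cancel
    simp [sub_eq_zero, hαβ.symm]
  have hne : ((((X + C (α - β)) ^ j : K[X]) : PowerSeries K) : LaurentSeries K) ≠ 0 := by
    intro h0
    have := congrArg (fun x : PowerSeries K => (x : LaurentSeries K)) hu
    simp only [PowerSeries.coe_mul, PowerSeries.coe_one, h0, zero_mul] at this
    exact zero_ne_one this
  have e : ((RatFunc.laurent α (RatFunc.C a / (RatFunc.X - RatFunc.C β) ^ j) : RatFunc K) :
      LaurentSeries K) = (((C a : K[X]) : PowerSeries K) *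
        ((((X + C (α - β)) ^ j : K[X]) : PowerSeries K))⁻¹ : PowerSeries K) := by
    have h1 := RatFunc.coe_coe (C a : K[X])
    have h2 := RatFunc.coe_coe ((X + C (α - β)) ^ j : K[X])
    simp only [RatFunc.coePolynomial] at h1 h2
    rw [h, map_div₀, ← h1, ← h2, div_eq_iff hne, ← PowerSeries.coe_mul, mul_assoc,
      mul_comm (_⁻¹), hu, mul_one]
  rw [polarCoeff, e, PowerSeries.coeff_coe, if_pos (by omega)]

/-- In every decomposition of `f` as a polynomial plus a finite sum of terms
`c α k / (x - α) ^ k`, the coefficients `c α k` are the `polarCoeff f α k`. -/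
theorem polarCoeff_of_partialFraction (f : RatFunc K) (P : K[X]) (S : Finset K) (m : ℕ)
    (c : K → ℕ → K)
    (hf : f = algebraMap K[X] (RatFunc K) P +
      ∑ α ∈ S, ∑ k ∈ Finset.Icc 1 m,
        RatFunc.C (c α k) / (RatFunc.X - RatFunc.C α) ^ k)
    (α : K) (hα : α ∈ S) (k : ℕ) (hk : k ∈ Finset.Icc 1 m) :
    polarCoeff f α k = c α k := by
  have hk1 : 1 ≤ k := (Finset.mem_Icc.mp hk).1
  rw [hf, polarCoeff_add, polarCoeff_polynomial _ _ _ hk1, zero_add, polarCoeff_sum,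
    Finset.sum_eq_single_of_mem α hα]
  · rw [polarCoeff_sum, Finset.sum_eq_single_of_mem k hk]
    · simp [polarCoeff_simple_self]
    · intro j _ hj
      simp [polarCoeff_simple_self, hj]
  · intro β _ hβ
    rw [polarCoeff_sum]
    exact Finset.sum_eq_zero fun j _ => polarCoeff_simple_of_ne _ _ _ hβ _ _ hk1

/-! ### Mahler trees and Mahler cycles -/

variable (K) in
/-- `α ∼ γ` if and only if `α ^ (p ^ r) = γ ^ (p ^ s)` for some `r, s ≥ 0`. -/
def treeSetoid (p : ℕ) : Setoid Kˣ where
  r α γ := ∃ r s : ℕ, α ^ p ^ r = γ ^ p ^ s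
  iseqv :=
    { refl := fun _ => ⟨0, 0, rfl⟩
      symm := fun ⟨r, s, h⟩ => ⟨s, r, h.symm⟩
      trans := by
        rintro α β γ ⟨r, s, h⟩ ⟨u, v, h'⟩
        refine ⟨r + u, v + s, ?_⟩
        rw [pow_add, pow_mul, h, ← pow_mul, mul_comm, pow_mul, h', ← pow_mul, ← pow_add] }

variable (K) in
/-- The set of Mahler trees: the equivalence classes in `Kˣ`. -/
def MahlerTree (p : ℕ) : Type _ := Quotient (treeSetoid K p)

variable {p : ℕ}

/-- The elements of a Mahler tree. -/
def MahlerTree.carrier (τ : MahlerTree K p) : Set Kˣ :=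
  {α | Quotient.mk (treeSetoid K p) α = τ}

/-- The Mahler cycle `C(τ)`: the roots of unity in `τ` whose order is coprime to `p`. -/
def MahlerTree.cycle (τ : MahlerTree K p) : Set Kˣ :=
  {γ | γ ∈ τ.carrier ∧ 0 < orderOf γ ∧ (orderOf γ).Coprime p}

/-- The cycle length `e = |C(τ)|`. -/
def MahlerTree.cycleLength (τ : MahlerTree K p) : ℕ := τ.cycle.ncard

/-- A tree is non-torsion if its cycle is empty, and torsion otherwise. -/
def MahlerTree.IsNonTorsion (τ : MahlerTree K p) : Prop := τ.cycle = ∅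

theorem MahlerTree.pow_mem_cycle {τ : MahlerTree K p} {γ : Kˣ} (h : γ ∈ τ.cycle) :
    γ ^ p ∈ τ.cycle := by
  obtain ⟨h1, h2, h3⟩ := h
  have ho : orderOf (γ ^ p) = orderOf γ := Nat.Coprime.orderOf_pow h3
  refine ⟨?_, by rwa [ho], by rwa [ho]⟩
  rw [← show _ = τ from h1]
  exact Quotient.sound ⟨0, 1, by simp⟩

/-! ### Poles of a rational function in a tree

For `α ∈ τ`, the coefficients `polarCoeff f α k` are those of the `τ`-component
`f_τ = ∑ k ≥ 1, ∑ α ∈ τ, c_k(α) / (x - α) ^ k` of `f`. -/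

/-- The coefficients `c_k(α)` in the partial fraction decomposition of `f`. -/
def coeffs (f : RatFunc K) (k : ℕ) (α : Kˣ) : K := polarCoeff f (α : K) k

/-- The order of `f` at a pole (and `0` if `α` is not a pole). -/
def poleOrder (f : RatFunc K) (α : Kˣ) : ℕ := f.denom.rootMultiplicity (α : K)

/-- The set `sing(f, τ)` of the poles of `f` that are contained in `τ`. -/
def sing (f : RatFunc K) (τ : MahlerTree K p) : Set Kˣ :=
  {α | α ∈ τ.carrier ∧ f.denom.IsRoot (α : K)}

/-- `ord(f, τ) = max ({0} ∪ {ord_α(f) | α ∈ sing(f, τ)})`. -/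
def treeOrder (f : RatFunc K) (τ : MahlerTree K p) : ℕ :=
  sSup ({0} ∪ poleOrder f '' sing f τ)

/-- `τ ∈ supp(f)`. -/
def InSupp (f : RatFunc K) (τ : MahlerTree K p) : Prop := (sing f τ).Nonempty

/-! ### Mahler coefficients -/

/-- The Mahler coefficient `V^m_{k,n}(α)`: the coefficient of `1 / (x - α) ^ k` in the partial
fraction decomposition of `1 / (x ^ (p ^ n) - α ^ (p ^ n)) ^ m`. -/
def mahlerCoeff (p m k n : ℕ) (α : Kˣ) : K :=
  polarCoeff (1 / (RatFunc.X ^ p ^ n - RatFunc.C ((α : K) ^ p ^ n)) ^ m) (α : K) k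

/-- The universal Mahler coefficient `𝕍^m_{k,n} ∈ ℚ`, for `1 ≤ k ≤ m`: the coefficient of
`(x - 1) ^ (m - k)` in the Taylor expansion at `x = 1` of
`(x ^ (p ^ n - 1) + ⋯ + x + 1) ^ (-m)`. Here `PowerSeries.X` stands for `x - 1`. -/
def univMahlerCoeff (p m k n : ℕ) : ℚ :=
  PowerSeries.coeff (m - k)
    ((∑ i ∈ Finset.range (p ^ n), (1 + PowerSeries.X : PowerSeries ℚ) ^ i) ^ m)⁻¹

/-! ### The cycle map and its `ω`-sections

Vectors `(d_k(γ))`, indexed by `k ≥ 1` and `γ ∈ C(τ)`, are given as functions `ℕ → Kˣ → K`, of which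
only the values at these indices matter. The bound `m` is such that `d_k(γ) = 0` for `k > m`. -/

/-- The cycle map `D_λ`:
`(d_k(γ)) ↦ (-d_k(γ) + p ^ λ * ∑ s ≥ k, V^s_{k,1}(γ) * d_s(γ ^ p))`. -/
def cycleMap (p : ℕ) (lam : ℤ) (m : ℕ) (d : ℕ → Kˣ → K) (k : ℕ) (γ : Kˣ) : K :=
  -d k γ + (p : K) ^ lam * ∑ s ∈ Finset.Icc k m, mahlerCoeff p s k 1 γ * d s (γ ^ p)

/-- The `0`-section of the cycle map, `(c_k(γ)) ↦ (d_k(γ))`, by descending recursion on `k`,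
where `e` is the cycle length. -/
def zeroSection (p : ℕ) (lam : ℤ) (e m : ℕ) (c : ℕ → Kˣ → K) (k : ℕ) (γ : Kˣ) : K :=
  if m < k then 0
  else
    let b : ℕ → K := fun j =>
      c k (γ ^ p ^ j) - (p : K) ^ lam * ∑ s ∈ (Finset.Icc (k + 1) m).attach,
        mahlerCoeff p s.1 k 1 (γ ^ p ^ j) * zeroSection p lam e m c s.1 (γ ^ p ^ (j + 1))
    if (k : ℤ) = lam then
      (γ : K) ^ k / (e : K) * ∑ j ∈ Finset.range e,
        ((j : K) + 1 - (e : K)) * (γ : K) ^ (-((k * p ^ j : ℕ) : ℤ)) * b j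
    else
      (γ : K) ^ k / ((p : K) ^ ((lam - k) * e) - 1) * ∑ j ∈ Finset.range e,
        (p : K) ^ ((lam - k) * j) * (γ : K) ^ (-((k * p ^ j : ℕ) : ℤ)) * b j
termination_by m + 1 - k
decreasing_by
  have := Finset.mem_Icc.mp s.2
  omega

/-- The vector `w^(L)` that spans the kernel of the cycle map for `λ = L ≥ 1`. -/
def kernelVector (p L e : ℕ) (k : ℕ) (γ : Kˣ) : K :=
  if L < k then 0
  else if k = L then (γ : K) ^ L
  else
    (p : K) ^ L * (γ : K) ^ k / (1 - (p : K) ^ ((L - k) * e)) *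
      ∑ j ∈ Finset.range e, ∑ s ∈ (Finset.Icc (k + 1) L).attach,
        (p : K) ^ ((L - k) * j) * (univMahlerCoeff p s.1 k 1 : K) *
          (γ : K) ^ (-((s.1 * p ^ (j + 1) : ℕ) : ℤ)) * kernelVector p L e s.1 (γ ^ p ^ (j + 1))
termination_by L + 1 - k
decreasing_by
  have := Finset.mem_Icc.mp s.2
  omega

/-- The `ω`-section of the cycle map. -/
def omegaSection (p : ℕ) (lam : ℤ) (e m : ℕ) (ω : K) (c : ℕ → Kˣ → K) (k : ℕ) (γ : Kˣ) : K :=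
  if lam ≤ 0 then zeroSection p lam e m c k γ
  else zeroSection p lam e m c k γ + ω * kernelVector p lam.toNat e k γ

/-! ### Heights -/

/-- The bouquet of height `h` rooted at `γ`. -/
def bouquet (τ : MahlerTree K p) (h : ℕ) (γ : Kˣ) : Set Kˣ :=
  {α | α ∈ τ.carrier ∧ ∃ n ≤ h, α ^ p ^ n = γ}

/-- The height `ht(f, τ)` for non-torsion `τ`: the smallest `h` such that `sing(f, τ)` is contained
in a bouquet of height `h`. -/
def bouquetHeight (f : RatFunc K) (τ : MahlerTree K p) : ℕ :=
  sInf {h | ∃ γ ∈ τ.carrier, sing f τ ⊆ bouquet τ h γ}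

/-- The root `γ ∈ τ` (unique if `τ` is a non-torsion tree in `supp(f)`) of the bouquet of height
`ht(f, τ)` that contains `sing(f, τ)`. -/
def bouquetRoot (f : RatFunc K) (τ : MahlerTree K p) : Kˣ :=
  Classical.epsilon fun γ => γ ∈ τ.carrier ∧ sing f τ ⊆ bouquet τ (bouquetHeight f τ) γ

/-- The bouquet `β(f, τ)`. -/
def bouquetOf (f : RatFunc K) (τ : MahlerTree K p) : Set Kˣ :=
  bouquet τ (bouquetHeight f τ) (bouquetRoot f τ)

/-- The height `η(α | f)` of `α ∈ β(f, τ)`, for non-torsion `τ`: the unique `n` such that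
`α ^ (p ^ n)` is the root of the bouquet. -/
def bouquetEta (f : RatFunc K) (τ : MahlerTree K p) (α : Kˣ) : ℕ :=
  sInf {n | α ^ p ^ n = bouquetRoot f τ}

/-- The height `η(α)` of `α ∈ τ`, for torsion `τ`: the smallest `n` such that
`α ^ (p ^ n) ∈ C(τ)`. -/
def torsionEta (τ : MahlerTree K p) (α : Kˣ) : ℕ :=
  sInf {n | α ^ p ^ n ∈ τ.cycle}

/-- The height `ht(f, τ) = max {η(α) | α ∈ sing(f, τ)}` for torsion `τ`. -/
def torsionHeight (f : RatFunc K) (τ : MahlerTree K p) : ℕ :=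
  sSup (torsionEta τ '' sing f τ)

/-! ### The `λ`-Mahler discrete residues -/

open Classical in
/-- `dres_λ(f, τ, k)_α` for non-torsion `τ`. -/
def nonTorsionRes (lam : ℤ) (f : RatFunc K) (τ : MahlerTree K p) (k : ℕ) (α : Kˣ) : K :=
  let h := bouquetHeight f τ
  let m := treeOrder f τ
  if ¬ InSupp f τ ∨ m < k then 0
  else if α ∈ bouquetOf f τ ∧ bouquetEta f τ α = h then
    ∑ s ∈ Finset.Icc k m, ∑ n ∈ Finset.range (h + 1),
      (p : K) ^ (lam * n) * mahlerCoeff p s k n α * coeffs f s (α ^ p ^ n)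
  else 0

/-- The residual average `ω_{λ,τ}(f)` for torsion `τ`. -/
def residualAverage (lam : ℤ) (f : RatFunc K) (τ : MahlerTree K p) : K :=
  let h := torsionHeight f τ
  let e := τ.cycleLength
  let m := treeOrder f τ
  let L := lam.toNat
  let d := zeroSection p lam e m (coeffs f)
  let c' := cycleMap p lam m d
  if lam ≤ 0 ∨ h = 0 then 0
  else
    1 / (((p : K) ^ h - (p : K) ^ (h - 1)) * (e : K)) *
        (∑ᶠ α ∈ {α : Kˣ | α ∈ τ.carrier ∧ torsionEta τ α = h},
          ∑ s ∈ Finset.Icc L m, ∑ n ∈ Finset.range h,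
            (p : K) ^ (lam * n) * (univMahlerCoeff p s L n : K) *
              (α : K) ^ (-((s * p ^ n : ℕ) : ℤ)) * coeffs f s (α ^ p ^ n))
      - (p : K) ^ (lam * (h - 1 : ℕ)) / (e : K) *
        (∑ᶠ γ ∈ τ.cycle, ∑ s ∈ Finset.Icc L m,
          (univMahlerCoeff p s L (h - 1) : K) * (γ : K) ^ (-(s : ℤ)) * (c' s γ + d s γ))

open Classical in
/-- `dres_λ(f, τ, k)_α` for torsion `τ`. -/
def torsionRes (lam : ℤ) (f : RatFunc K) (τ : MahlerTree K p) (k : ℕ) (α : Kˣ) : K :=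
  let h := torsionHeight f τ
  let e := τ.cycleLength
  let m := treeOrder f τ
  let d := omegaSection p lam e m (residualAverage lam f τ) (coeffs f)
  let c' := cycleMap p lam m d
  if ¬ InSupp f τ ∨ m < k then 0
  else if h = 0 then (if torsionEta τ α = 0 then coeffs f k α else 0)
  else if torsionEta τ α = h then
    (∑ s ∈ Finset.Icc k m, ∑ n ∈ Finset.range h,
        (p : K) ^ (lam * n) * mahlerCoeff p s k n α * coeffs f s (α ^ p ^ n))
      - (p : K) ^ (lam * (h - 1 : ℕ)) * ∑ s ∈ Finset.Icc k m,
        (univMahlerCoeff p s k (h - 1) : K) *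
          (α : K) ^ ((k : ℤ) - ((s * p ^ (h + e - 1) : ℕ) : ℤ)) *
          (c' s (α ^ p ^ (h + e - 1)) + d s (α ^ p ^ (h + e - 1)))
  else if (k : ℤ) = lam ∧ torsionEta τ α = 0 then coeffs f k α - c' k α
  else 0

open Classical in
/-- The `λ`-Mahler discrete residue `dres_λ(f, τ, k) = (dres_λ(f, τ, k)_α)_{α ∈ τ}` of `f` at `τ` of
degree `k ≥ 1`. -/
def twistedRes (lam : ℤ) (f : RatFunc K) (τ : MahlerTree K p) (k : ℕ) : τ.carrier → K := fun α =>
  if τ.IsNonTorsion then nonTorsionRes lam f τ k α else torsionRes lam f τ k α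

/-! ### The recursively defined (untwisted) Mahler discrete residues -/

/-- One level of the recursion at a time, the poles are pushed up the tree: starting from `base` at
height `0`, the coefficient at an element `α` of height `n + 1` is `c_k(α)` plus the contribution
`∑ s ≥ k, V^s_{k,1}(α) * (coefficient of degree s at α ^ p, of height n)`. -/
def pushUp (p m : ℕ) (c base : ℕ → Kˣ → K) : ℕ → ℕ → Kˣ → K
  | 0, k, α => base k α
  | n + 1, k, α =>
      c k α + ∑ s ∈ Finset.Icc k m, mahlerCoeff p s k 1 α * pushUp p m c base n s (α ^ p)

open Classical in
/-- The recursive residue `dres(f, τ, k)_α` for non-torsion `τ`. -/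
def recNonTorsionRes (f : RatFunc K) (τ : MahlerTree K p) (k : ℕ) (α : Kˣ) : K :=
  let h := bouquetHeight f τ
  let m := treeOrder f τ
  if ¬ InSupp f τ ∨ m < k then 0
  else if α ∈ bouquetOf f τ ∧ bouquetEta f τ α = h then
    pushUp p m (coeffs f) (coeffs f) h k α
  else 0

/-- Vectors `(d_k(γ))` with `1 ≤ k ≤ m` and `γ ∈ C(τ)`. -/
abbrev CycleVec (τ : MahlerTree K p) (m : ℕ) : Type _ := Finset.Icc 1 m → τ.cycle → K

/-- The truncated linear map
`(d_k(γ)) ↦ (d_k(γ) - ∑ k ≤ s ≤ m, V^s_{k,1}(γ) * d_s(γ ^ p))`. -/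
def truncCycleMap (τ : MahlerTree K p) (m : ℕ) : CycleVec τ m →ₗ[K] CycleVec τ m where
  toFun d k γ := d k γ - ∑ s : Finset.Icc 1 m with k ≤ s,
    mahlerCoeff p s k 1 γ * d s ⟨(γ : Kˣ) ^ p, MahlerTree.pow_mem_cycle γ.2⟩
  map_add' d d' := by
    ext k γ
    simp only [Pi.add_apply, mul_add, Finset.sum_add_distrib]
    ring
  map_smul' a d := by
    ext k γ
    simp only [Pi.smul_apply, smul_eq_mul, RingHom.id_apply, mul_sub, Finset.mul_sum]
    congr 1
    exact Finset.sum_congr rfl fun s _ => by ring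

/-- The inverse of the (bijective) map `truncCycleMap`. -/
def auxMap (τ : MahlerTree K p) (m : ℕ) : CycleVec τ m → CycleVec τ m :=
  Function.invFun (truncCycleMap τ m)

open Classical in
/-- The vector `d = auxMap (c)`, where `c` consists of the coefficients of `f` at the cycle,
extended by zero. -/
def auxVector (f : RatFunc K) (τ : MahlerTree K p) (k : ℕ) (γ : Kˣ) : K :=
  if hk : k ∈ Finset.Icc 1 (treeOrder f τ) ∧ γ ∈ τ.cycle then
    auxMap τ (treeOrder f τ) (fun s δ => coeffs f s δ) ⟨k, hk.1⟩ ⟨γ, hk.2⟩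
  else 0

open Classical in
/-- The recursive residue `dres(f, τ, k)_α` for torsion `τ`. -/
def recTorsionRes (f : RatFunc K) (τ : MahlerTree K p) (k : ℕ) (α : Kˣ) : K :=
  let h := torsionHeight f τ
  let m := treeOrder f τ
  if ¬ InSupp f τ ∨ m < k then 0
  else if torsionEta τ α = h then
    if h = 0 then coeffs f k α else pushUp p m (coeffs f) (auxVector f τ) h k α
  else 0

open Classical in
/-- The (untwisted) Mahler discrete residue `dres(f, τ, k) = (dres(f, τ, k)_α)_{α ∈ τ}` of `f` at
`τ` of degree `k ≥ 1`, defined recursively. -/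
def recursiveRes (f : RatFunc K) (τ : MahlerTree K p) (k : ℕ) : τ.carrier → K := fun α =>
  if τ.IsNonTorsion then recNonTorsionRes f τ k α else recTorsionRes f τ k α

end Mahler
end

noncomputable section

namespace Mahler

variable {K : Type*} [Field K]

/-! Passing from x to x^(p^(n+r)) is passing to x^(p^r) and then to x^(p^n), so Mahler coefficients
obey a composition law, V^s_{k,n+1}(α) = ∑_j V^j_{k,1}(α) V^s_{j,n}(α^p) (`mahlerCoeff_succ`). It is
proved for the universal coefficients (`univMahlerCoeff_add`) and transferred by scaling
(`mahlerCoeff_eq`). It unrolls the recursion (∗): the pushed-up coefficient is an explicit sum of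
V^s_{k,i}(α) c_s(α^(p^i)) over i < n, plus V^s_{k,n}(α) times the base vector at α^(p^n)
(`pushUp_eq`).

For a non-torsion tree the base vector is c itself, and the closed form is already dres₀.

For a torsion tree the explicit 0-section d inverts the cycle map (`cycleMap_zeroSection`). The
truncated map is the negative of the cycle map, so the base vector is δ = -d (`auxVector_eq`). What
remains is to match ∑ V^s_{k,h}(α) d_s(α^(p^h)) with the correction term of dres₀. There c̃ + d at
α^(p^(h+e-1)) is one Mahler step applied to d at α^(p^(h+e)) = α^(p^h), and the composition law for
h = 1 + (h-1) finishes the proof. -/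

/-! ### Composition law for the universal Mahler coefficients -/

/-- The geometric sum in `1 + X`, i.e. `((1 + X) ^ q - 1) / X`. -/
def geomPoly (R : Type*) [CommRing R] (q : ℕ) : R[X] := ∑ i ∈ Finset.range q, (1 + X) ^ i

theorem X_mul_geomPoly (R : Type*) [CommRing R] (q : ℕ) :
    X * geomPoly R q = (1 + X) ^ q - 1 := by
  have := mul_geom_sum (1 + X : R[X]) q
  simpa [geomPoly] using this

/-- With P = (1+X)^b - 1 one has (1+P)^a = (1+X)^(ab); dividing this by X in two stages gives the
factorization. -/
theorem geomPoly_mul (a b : ℕ) :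
    geomPoly ℚ (a * b) = aeval ((1 + X) ^ b - 1 : ℚ[X]) (geomPoly ℚ a) * geomPoly ℚ b := by
  apply mul_left_cancel₀ (X_ne_zero (R := ℚ))
  rw [mul_left_comm, X_mul_geomPoly, X_mul_geomPoly, mul_comm (aeval _ _)]
  have := congrArg (aeval ((1 + X) ^ b - 1 : ℚ[X])) (X_mul_geomPoly ℚ a)
  simp only [map_mul, map_sub, map_pow, map_add, map_one, aeval_X, add_sub_cancel] at this
  rw [this, ← pow_mul, mul_comm a b]

theorem constantCoeff_geomPoly (R : Type*) [CommRing R] (q : ℕ) :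
    PowerSeries.constantCoeff (geomPoly R q : PowerSeries R) = q := by
  simp [geomPoly, Polynomial.eval_finsetSum, Polynomial.coeff_zero_eq_eval_zero]

theorem univMahlerCoeff_eq (p s k n : ℕ) :
    univMahlerCoeff p s k n =
      PowerSeries.coeff (s - k) ((geomPoly ℚ (p ^ n) : PowerSeries ℚ) ^ s)⁻¹ := by
  have : (geomPoly ℚ (p ^ n) : PowerSeries ℚ) =
      ∑ i ∈ Finset.range (p ^ n), (1 + PowerSeries.X : PowerSeries ℚ) ^ i := by
    have := map_sum (Polynomial.coeToPowerSeries.ringHom (R := ℚ))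
      (fun i => (1 + X : ℚ[X]) ^ i) (Finset.range (p ^ n))
    rw [geomPoly]
    refine this.trans (Finset.sum_congr rfl fun i _ => ?_)
    simp [Polynomial.coeToPowerSeries.ringHom_apply]
  rw [univMahlerCoeff, this]

/-- Coefficients of the `s`-th inverse power of a composition of the polynomials
`(1 + X) ^ q - 1`. -/
theorem coeff_inv_geomPoly_mul (a b s N : ℕ) (ha : a ≠ 0) (hb : b ≠ 0) (hN : N ≤ s) :
    PowerSeries.coeff N ((geomPoly ℚ (a * b) : PowerSeries ℚ) ^ s)⁻¹ =
      ∑ i ∈ Finset.range (N + 1),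
        PowerSeries.coeff i ((geomPoly ℚ a : PowerSeries ℚ) ^ s)⁻¹ *
          PowerSeries.coeff (N - i) ((geomPoly ℚ b : PowerSeries ℚ) ^ (s - i))⁻¹ := by
  have hc : ∀ q : ℕ, q ≠ 0 → ∀ t : ℕ,
      PowerSeries.constantCoeff ((geomPoly ℚ q : PowerSeries ℚ) ^ t) ≠ 0 := by
    intro q hq t
    rw [map_pow, constantCoeff_geomPoly]
    positivity
  set W := ((geomPoly ℚ a : PowerSeries ℚ) ^ s)⁻¹ with hW
  -- Truncation makes the substitution X ↦ (1+X)^b - 1 a polynomial evaluation. The error is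
  -- divisible by X^(N+1) and stays so, because X divides (1+X)^b - 1.
  set A : ℚ[X] := PowerSeries.trunc (N + 1) W with hA
  obtain ⟨Q, hQ⟩ : (X : ℚ[X]) ^ (N + 1) ∣ 1 - geomPoly ℚ a ^ s * A := by
    have h1 : (PowerSeries.X : PowerSeries ℚ) ^ (N + 1) ∣ W - A := by
      rw [PowerSeries.X_pow_dvd_iff]
      intro i hi
      simp [hA, PowerSeries.coeff_trunc, hi]
    have h2 : (PowerSeries.X : PowerSeries ℚ) ^ (N + 1) ∣
        ((1 - geomPoly ℚ a ^ s * A : ℚ[X]) : PowerSeries ℚ) := by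
      have e : ((1 - geomPoly ℚ a ^ s * A : ℚ[X]) : PowerSeries ℚ) =
          (geomPoly ℚ a : PowerSeries ℚ) ^ s * (W - A) := by
        rw [mul_sub, hW, PowerSeries.mul_inv_cancel _ (hc a ha s)]
        simp
      rw [e]
      exact h1.mul_left _
    rw [Polynomial.X_pow_dvd_iff]
    intro i hi
    rw [PowerSeries.X_pow_dvd_iff] at h2
    simpa only [Polynomial.coeff_coe] using h2 i hi
  set P : ℚ[X] := (1 + X) ^ b - 1 with hP
  have hPX : P = X * geomPoly ℚ b := (X_mul_geomPoly ℚ b).symm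
  have hcomp := congrArg (aeval P) hQ
  simp only [map_sub, map_one, map_mul, map_pow, aeval_X] at hcomp
  have hAs : aeval P A = ∑ i ∈ Finset.range (N + 1),
      C (PowerSeries.coeff i W) * (X ^ i * geomPoly ℚ b ^ i) := by
    have hA' : A = ∑ i ∈ Finset.range (N + 1), monomial i (PowerSeries.coeff i W) := by
      ext j
      simp [hA, PowerSeries.coeff_trunc, Polynomial.coeff_monomial]
    rw [hA', map_sum]
    refine Finset.sum_congr rfl fun i _ => ?_
    rw [aeval_monomial, hPX, mul_pow]
    rfl
  set Bs := (geomPoly ℚ b : PowerSeries ℚ) with hBs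
  have hBne := hc b hb
  have hcoe := congrArg (fun x : ℚ[X] => (x : PowerSeries ℚ)) hcomp
  have key : ((geomPoly ℚ (a * b) : PowerSeries ℚ) ^ s)⁻¹ =
      (Bs ^ s)⁻¹ * ((aeval P A : ℚ[X]) : PowerSeries ℚ) +
      PowerSeries.X ^ (N + 1) * (Bs ^ (N + 1) * ((aeval P Q : ℚ[X]) : PowerSeries ℚ) *
        ((geomPoly ℚ (a * b) : PowerSeries ℚ) ^ s)⁻¹) := by
    have hne := PowerSeries.mul_inv_cancel _ (hc (a * b) (mul_ne_zero ha hb) s)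
    have hne2 := PowerSeries.mul_inv_cancel _ (hBne s)
    have h3 : (geomPoly ℚ (a * b) : PowerSeries ℚ) ^ s =
        ((aeval P (geomPoly ℚ a) : ℚ[X]) : PowerSeries ℚ) ^ s * Bs ^ s := by
      rw [geomPoly_mul, Polynomial.coe_mul, mul_pow]
    have h4 : 1 - ((aeval P (geomPoly ℚ a) : ℚ[X]) : PowerSeries ℚ) ^ s *
        ((aeval P A : ℚ[X]) : PowerSeries ℚ) =
        PowerSeries.X ^ (N + 1) * Bs ^ (N + 1) * ((aeval P Q : ℚ[X]) : PowerSeries ℚ) := by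
      have : P ^ (N + 1) = X ^ (N + 1) * geomPoly ℚ b ^ (N + 1) := by rw [hPX, mul_pow]
      rw [this] at hcoe
      simpa using hcoe
    set I := ((geomPoly ℚ (a * b) : PowerSeries ℚ) ^ s)⁻¹
    set J := (Bs ^ s)⁻¹
    set G := (geomPoly ℚ (a * b) : PowerSeries ℚ) ^ s
    set H := ((aeval P (geomPoly ℚ a) : ℚ[X]) : PowerSeries ℚ) ^ s
    set AA := ((aeval P A : ℚ[X]) : PowerSeries ℚ)
    have hJ : J = H * I := by
      calc J = J * (G * I) := by rw [hne, mul_one]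
        _ = (Bs ^ s * J) * (H * I) := by rw [h3]; ring
        _ = H * I := by rw [hne2, one_mul]
    rw [hJ]
    linear_combination I * h4
  rw [key, map_add, PowerSeries.coeff_X_pow_mul', if_neg (by omega), add_zero, hAs]
  have hsum : ((∑ i ∈ Finset.range (N + 1),
      C (PowerSeries.coeff i W) * (X ^ i * geomPoly ℚ b ^ i) : ℚ[X]) : PowerSeries ℚ) =
      ∑ i ∈ Finset.range (N + 1),
        PowerSeries.C (PowerSeries.coeff i W) * (PowerSeries.X ^ i * Bs ^ i) := by
    have := map_sum (Polynomial.coeToPowerSeries.ringHom (R := ℚ))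
      (fun i => C (PowerSeries.coeff i W) * (X ^ i * geomPoly ℚ b ^ i)) (Finset.range (N + 1))
    refine this.trans (Finset.sum_congr rfl fun i _ => ?_)
    simp [Polynomial.coeToPowerSeries.ringHom_apply, hBs]
  rw [hsum, Finset.mul_sum, map_sum]
  refine Finset.sum_congr rfl fun i hi => ?_
  have hiN : i ≤ N := by simpa [Nat.lt_succ_iff] using hi
  -- Here N ≤ s matters: it makes s - i a true subtraction.
  have h5 : (Bs ^ s)⁻¹ * Bs ^ i = (Bs ^ (s - i))⁻¹ := by
    rw [PowerSeries.eq_inv_iff_mul_eq_one (hBne _), mul_assoc, ← pow_add,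
      Nat.add_sub_cancel' (hiN.trans hN), PowerSeries.inv_mul_cancel _ (hBne s)]
  rw [show (Bs ^ s)⁻¹ * (PowerSeries.C (PowerSeries.coeff i W) * (PowerSeries.X ^ i * Bs ^ i)) =
    PowerSeries.C (PowerSeries.coeff i W) * (PowerSeries.X ^ i * ((Bs ^ s)⁻¹ * Bs ^ i)) by ring,
    PowerSeries.coeff_C_mul, PowerSeries.coeff_X_pow_mul', if_pos hiN, h5]

/-- The composition formula with a = p^n, b = p^r and N = s - k, reindexed by the intermediate pole
order j = s - i. -/
theorem univMahlerCoeff_add (p s k n r : ℕ) (hp : 2 ≤ p) (hks : k ≤ s) :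
    univMahlerCoeff p s k (n + r) =
      ∑ j ∈ Finset.Icc k s, univMahlerCoeff p s j n * univMahlerCoeff p j k r := by
  simp only [univMahlerCoeff_eq]
  rw [pow_add, coeff_inv_geomPoly_mul _ _ _ _ (by positivity) (by positivity) (by omega)]
  refine Finset.sum_bij' (fun i _ => s - i) (fun j _ => s - j) ?_ ?_ ?_ ?_ ?_
  · intro i hi
    simp only [Finset.mem_range, Finset.mem_Icc] at *
    omega
  · intro i hi
    simp only [Finset.mem_range, Finset.mem_Icc] at *
    omega
  · intro i hi
    simp only [Finset.mem_range] at *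
    omega
  · intro i hi
    simp only [Finset.mem_Icc] at *
    omega
  · intro i hi
    simp only [Finset.mem_range] at hi
    rw [show s - (s - i) = i by omega, show s - i - k = s - k - i by omega]

theorem univMahlerCoeff_zero (p s k : ℕ) (hks : k ≤ s) :
    univMahlerCoeff p s k 0 = if s = k then 1 else 0 := by
  have : (s - k = 0) ↔ s = k := by omega
  simp [univMahlerCoeff, PowerSeries.coeff_one, this]

theorem univMahlerCoeff_self (p k n : ℕ) : univMahlerCoeff p k k n = ((p : ℚ) ^ (n * k))⁻¹ := by
  rw [univMahlerCoeff_eq, Nat.sub_self, PowerSeries.coeff_zero_eq_constantCoeff_apply,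
    PowerSeries.constantCoeff_inv, map_pow, constantCoeff_geomPoly, Nat.cast_pow, pow_mul]

/-! ### Mahler coefficients at a point -/

/-- Mahler coefficients are monomial multiples of the universal ones. -/
theorem mahlerCoeff_eq [CharZero K] (p s k n : ℕ) (hp : 2 ≤ p) (hks : k ≤ s) (α : Kˣ) :
    mahlerCoeff p s k n α =
      (univMahlerCoeff p s k n : K) * (α : K) ^ ((k : ℤ) - ((s * p ^ n : ℕ) : ℤ)) := by
  set q := p ^ n with hq
  have hq0 : q ≠ 0 := by positivity
  have hα : (α : K) ≠ 0 := α.ne_zero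
  -- After the shift by α the denominator x^q - α^q becomes X * G, and G has nonzero constant term q
  -- α^(q-1) in characteristic 0.
  set G : K[X] := ∑ i ∈ Finset.range q, (X + C (α : K)) ^ i * C (α : K) ^ (q - 1 - i) with hG
  have hXG : X * G = (X + C (α : K)) ^ q - C (α : K) ^ q := by
    have := (Commute.all (X + C (α : K)) (C (α : K))).mul_geom_sum₂ q
    simpa [hG] using this
  have hG0 : PowerSeries.constantCoeff (G : PowerSeries K) = q * (α : K) ^ (q - 1) := by
    have : ∀ i ∈ Finset.range q, (α : K) ^ i * (α : K) ^ (q - 1 - i) = (α : K) ^ (q - 1) := by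
      intro i hi
      rw [← pow_add]
      congr 1
      simp at hi
      omega
    rw [Polynomial.constantCoeff_coe, Polynomial.coeff_zero_eq_eval_zero, hG,
      Polynomial.eval_finsetSum]
    simp [Finset.sum_congr rfl this]
  have hGs : PowerSeries.constantCoeff ((G : PowerSeries K) ^ s) ≠ 0 := by
    rw [map_pow, hG0]
    exact pow_ne_zero _ (mul_ne_zero (by exact_mod_cast hq0) (pow_ne_zero _ hα))
  have hlaur : mahlerCoeff p s k n α =
      PowerSeries.coeff (s - k) ((G : PowerSeries K) ^ s)⁻¹ := by
    have h1 : (RatFunc.laurent (α : K)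
        (1 / (RatFunc.X ^ q - RatFunc.C ((α : K) ^ q)) ^ s) : RatFunc K) =
        1 / algebraMap K[X] (RatFunc K) ((X * G) ^ s) := by
      rw [hXG]
      simp
    have h2 := RatFunc.coe_coe ((X * G) ^ s : K[X])
    simp only [RatFunc.coePolynomial] at h2
    have h3 : (((X * G) ^ s : K[X]) : PowerSeries K) =
        PowerSeries.X ^ s * (G : PowerSeries K) ^ s := by
      simp [mul_pow]
    have hne : ((PowerSeries.X ^ s * (G : PowerSeries K) ^ s : PowerSeries K) :
        LaurentSeries K) ≠ 0 := by
      intro h0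
      have hz : PowerSeries.X ^ s * (G : PowerSeries K) ^ s = 0 := by
        apply HahnSeries.ofPowerSeries_injective (Γ := ℤ)
        rw [h0, map_zero]
      rcases mul_eq_zero.mp hz with h | h
      · exact pow_ne_zero _ PowerSeries.X_ne_zero h
      · rw [h, map_zero] at hGs
        exact hGs rfl
    have h4 : ((RatFunc.laurent (α : K)
        (1 / (RatFunc.X ^ q - RatFunc.C ((α : K) ^ q)) ^ s) : RatFunc K) : LaurentSeries K) =
        HahnSeries.single (-(s : ℤ)) 1 *
          ((((G : PowerSeries K) ^ s)⁻¹ : PowerSeries K) : LaurentSeries K) := by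
      rw [h1, map_div₀, map_one, ← h2, h3, div_eq_iff hne, PowerSeries.coe_mul, PowerSeries.coe_pow,
        PowerSeries.coe_X, HahnSeries.single_pow, mul_mul_mul_comm, HahnSeries.single_mul_single,
        ← PowerSeries.coe_mul, PowerSeries.inv_mul_cancel _ hGs]
      simp
    rw [mahlerCoeff, polarCoeff, ← hq, h4,
      show (-(k : ℤ)) = ((s - k : ℕ) : ℤ) + (-(s : ℤ)) by push_cast [hks]; ring,
      HahnSeries.coeff_single_mul_add, one_mul, LaurentSeries.coeff_coe_powerSeries]
  -- Homogeneity: substituting X = αY turns (X+α)^q - α^q into α^q ((1+Y)^q - 1).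
  have hGU : (G : PowerSeries K) = PowerSeries.C ((α : K) ^ (q - 1)) *
      PowerSeries.rescale (α : K)⁻¹
        (PowerSeries.map (algebraMap ℚ K) (geomPoly ℚ q : PowerSeries ℚ)) := by
    have hXne := PowerSeries.X_ne_zero (R := K)
    apply mul_left_cancel₀ hXne
    have h1 : (PowerSeries.X : PowerSeries K) * (G : PowerSeries K) =
        (PowerSeries.X + PowerSeries.C (α : K)) ^ q - PowerSeries.C (α : K) ^ q := by
      have := congrArg (fun x : K[X] => (x : PowerSeries K)) hXG
      simpa using this
    have h2 : (PowerSeries.X : PowerSeries ℚ) * (geomPoly ℚ q : PowerSeries ℚ) =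
        (1 + PowerSeries.X) ^ q - 1 := by
      have := congrArg (fun x : ℚ[X] => (x : PowerSeries ℚ)) (X_mul_geomPoly ℚ q)
      simpa using this
    have h3 := congrArg (fun x => PowerSeries.rescale (α : K)⁻¹
      (PowerSeries.map (algebraMap ℚ K) x)) h2
    simp only [map_mul, map_sub, map_pow, map_add, map_one, PowerSeries.map_X,
      PowerSeries.rescale_X] at h3
    have hCC : PowerSeries.C (α : K) * PowerSeries.C (α : K)⁻¹ = 1 := by
      rw [← map_mul, mul_inv_cancel₀ hα, map_one]
    have hfac : PowerSeries.X + PowerSeries.C (α : K) =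
        PowerSeries.C (α : K) * (1 + PowerSeries.C (α : K)⁻¹ * PowerSeries.X) := by
      rw [mul_add, ← mul_assoc, hCC]
      ring
    rw [h1, hfac, mul_pow]
    obtain ⟨r, hr⟩ : ∃ r, q = r + 1 := ⟨q - 1, by omega⟩
    rw [map_pow]
    rw [show q - 1 = r by omega]
    have : PowerSeries.C (α : K) ^ q = PowerSeries.C (α : K) ^ r * PowerSeries.C (α : K) := by
      rw [hr, pow_succ]
    rw [this]
    linear_combination (-(PowerSeries.C (α : K) ^ r * PowerSeries.C (α : K))) * h3 +
      PowerSeries.C (α : K) ^ r * PowerSeries.X * (PowerSeries.rescale (α : K)⁻¹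
        (PowerSeries.map (algebraMap ℚ K) (geomPoly ℚ q : PowerSeries ℚ))) * hCC
  have hinv : ((G : PowerSeries K) ^ s)⁻¹ = PowerSeries.C (((α : K) ^ (q - 1)) ^ s)⁻¹ *
      PowerSeries.rescale (α : K)⁻¹
        (PowerSeries.map (algebraMap ℚ K) ((geomPoly ℚ q : PowerSeries ℚ) ^ s)⁻¹) := by
    symm
    rw [PowerSeries.eq_inv_iff_mul_eq_one hGs, hGU, mul_pow, mul_mul_mul_comm, ← map_pow,
      ← map_pow, ← map_pow, ← map_mul, ← map_mul, ← map_mul, inv_mul_cancel₀ (by positivity),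
      PowerSeries.inv_mul_cancel]
    · simp
    · rw [map_pow, constantCoeff_geomPoly]
      positivity
  rw [hlaur, hinv, PowerSeries.coeff_C_mul, PowerSeries.coeff_rescale, PowerSeries.coeff_map,
    univMahlerCoeff_eq, ← hq, eq_ratCast, ← mul_assoc, mul_comm]
  congr 1
  rw [← pow_mul, inv_pow, ← mul_inv, ← pow_add, ← zpow_natCast, ← zpow_neg]
  congr 1
  obtain ⟨r, hr⟩ : ∃ r, q = r + 1 := ⟨q - 1, by omega⟩
  rw [hr]
  push_cast [hks]
  simp
  ring

theorem mahlerCoeff_zero [CharZero K] (p s k : ℕ) (hp : 2 ≤ p) (hks : k ≤ s) (α : Kˣ) :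
    mahlerCoeff p s k 0 α = if s = k then 1 else 0 := by
  rw [mahlerCoeff_eq p s k 0 hp hks, univMahlerCoeff_zero p s k hks]
  split_ifs with h
  · simp [h]
  · simp

/-- The powers of α fit the universal law because (k - jp) + p(j - sp^n) = k - sp^(n+1),
independently of j. -/
theorem mahlerCoeff_succ [CharZero K] (p s k n : ℕ) (hp : 2 ≤ p) (hks : k ≤ s) (α : Kˣ) :
    mahlerCoeff p s k (n + 1) α =
      ∑ j ∈ Finset.Icc k s, mahlerCoeff p j k 1 α * mahlerCoeff p s j n (α ^ p) := by
  rw [mahlerCoeff_eq p s k _ hp hks, univMahlerCoeff_add p s k n 1 hp hks, Rat.cast_sum,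
    Finset.sum_mul]
  refine Finset.sum_congr rfl fun j hj => ?_
  obtain ⟨h1, h2⟩ := Finset.mem_Icc.mp hj
  rw [mahlerCoeff_eq p j k 1 hp h1, mahlerCoeff_eq p s j n hp h2, Rat.cast_mul,
    Units.val_pow_eq_pow_val, ← zpow_natCast (α : K) p, ← zpow_mul, mul_mul_mul_comm,
    ← zpow_add₀ α.ne_zero, mul_comm (univMahlerCoeff p s j n : K)]
  congr 2
  push_cast
  ring

/-! ### Unrolling the recursion -/

/-- Closed form of the recursion `pushUp`. -/
theorem pushUp_eq [CharZero K] (p m : ℕ) (hp : 2 ≤ p) (c base : ℕ → Kˣ → K) (n k : ℕ)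
    (hk : k ≤ m) (α : Kˣ) :
    pushUp p m c base n k α = ∑ s ∈ Finset.Icc k m,
      ((∑ i ∈ Finset.range n, mahlerCoeff p s k i α * c s (α ^ p ^ i)) +
        mahlerCoeff p s k n α * base s (α ^ p ^ n)) := by
  have hdelta : ∀ (g : ℕ → K) (k : ℕ), k ≤ m → ∀ α : Kˣ,
      ∑ s ∈ Finset.Icc k m, mahlerCoeff p s k 0 α * g s = g k := by
    intro g k hk α
    rw [Finset.sum_eq_single_of_mem k (Finset.mem_Icc.mpr ⟨le_rfl, hk⟩)]
    · rw [mahlerCoeff_zero p k k hp le_rfl, if_pos rfl, one_mul]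
    · intro s hs hsk
      rw [mahlerCoeff_zero p s k hp (Finset.mem_Icc.mp hs).1, if_neg hsk, zero_mul]
  induction n generalizing k α with
  | zero => simpa [pushUp] using (hdelta (fun s => base s α) k hk α).symm
  | succ n ih =>
    -- The composition law summed against an arbitrary g, after exchanging the order over the
    -- triangle k ≤ j ≤ s ≤ m.
    have hstep : ∀ (i : ℕ) (g : ℕ → K),
        ∑ s ∈ Finset.Icc k m, mahlerCoeff p s k (i + 1) α * g s =
          ∑ j ∈ Finset.Icc k m, mahlerCoeff p j k 1 α *
            ∑ s ∈ Finset.Icc j m, mahlerCoeff p s j i (α ^ p) * g s := by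
      intro i g
      simp only [Finset.mul_sum]
      rw [Finset.sum_sigma', Finset.sum_congr rfl fun s hs => by
        rw [mahlerCoeff_succ p s k i hp (Finset.mem_Icc.mp hs).1 α, Finset.sum_mul],
        Finset.sum_sigma']
      refine Finset.sum_bij' (fun x _ => ⟨x.2, x.1⟩) (fun x _ => ⟨x.2, x.1⟩) ?_ ?_ ?_ ?_ ?_
      · rintro ⟨a, b⟩ h
        simp only [Finset.mem_sigma, Finset.mem_Icc] at *
        omega
      · rintro ⟨a, b⟩ h
        simp only [Finset.mem_sigma, Finset.mem_Icc] at *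
        omega
      · intros; rfl
      · intros; rfl
      · intros; ring
    have hpow : ∀ i : ℕ, (α ^ p) ^ p ^ i = α ^ p ^ (i + 1) := fun i => by
      rw [← pow_mul, pow_succ']
    rw [pushUp, Finset.sum_congr rfl fun s hs => by
      rw [ih s (Finset.mem_Icc.mp hs).2 (α ^ p)]]
    simp only [Finset.sum_add_distrib, mul_add, hpow]
    rw [hstep n (fun s => base s (α ^ p ^ (n + 1))), ← add_assoc]
    congr 1
    -- The term i = 0 is split off; by `hdelta` it is the summand c_k(α) of the recursion.
    simp only [Finset.sum_range_succ' _ n, Finset.sum_add_distrib]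
    rw [hdelta (fun s => c s (α ^ p ^ 0)) k hk α, add_comm]
    simp only [pow_zero, pow_one]
    congr 1
    rw [Finset.sum_comm, Finset.sum_congr rfl fun i _ => hstep i _]
    rw [Finset.sum_comm]
    refine Finset.sum_congr rfl fun j _ => ?_
    rw [← Finset.mul_sum, Finset.sum_comm]

/-! ### The cycle -/

variable {p : ℕ}

/-- Euler's theorem: p is a unit modulo the order N of γ, so φ(N) iterations fix γ. -/
theorem MahlerTree.isPeriodicPt_of_mem_cycle {τ : MahlerTree K p} {γ : Kˣ} (h : γ ∈ τ.cycle) :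
    γ ∈ Function.periodicPts (fun x : Kˣ => x ^ p) := by
  obtain ⟨-, h2, h3⟩ := h
  refine Function.mk_mem_periodicPts (Nat.totient_pos.mpr h2) ?_
  change (fun x : Kˣ => x ^ p)^[_] γ = γ
  rw [pow_iterate]
  have := Nat.ModEq.pow_totient h3.symm
  simpa using pow_eq_pow_iff_modEq.mpr this

theorem MahlerTree.pow_pow_mem_cycle {τ : MahlerTree K p} {γ : Kˣ} (h : γ ∈ τ.cycle) (j : ℕ) :
    γ ^ p ^ j ∈ τ.cycle := by
  induction j with
  | zero => simpa using h
  | succ j ih =>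
    rw [pow_succ, pow_mul]
    exact MahlerTree.pow_mem_cycle ih

/-- The cycle is a single orbit of the `p`-power map. -/
theorem MahlerTree.cycle_eq_image {τ : MahlerTree K p} {γ : Kˣ} (h : γ ∈ τ.cycle) :
    τ.cycle = (fun j => γ ^ p ^ j) ''
      (Finset.range (Function.minimalPeriod (fun x : Kˣ => x ^ p) γ) : Set ℕ) := by
  ext δ
  constructor
  · intro hδ
    obtain ⟨M, hM, hper⟩ := MahlerTree.isPeriodicPt_of_mem_cycle hδ
    have hrel : (treeSetoid K p).r γ δ := Quotient.exact (h.1.trans hδ.1.symm)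
    obtain ⟨r, s, hrs⟩ := hrel
    have hper' : δ ^ p ^ (M * s) = δ := by
      have := hper.mul_const s
      change (fun x : Kˣ => x ^ p)^[_] δ = δ at this
      rwa [pow_iterate] at this
    -- From γ^(p^r) = δ^(p^s), a further Ms - s iterations bring δ^(p^s) back to δ, since M is a
    -- period of δ.
    have hδγ : δ = γ ^ p ^ (r + (M * s - s)) := by
      have hle : s ≤ M * s := Nat.le_mul_of_pos_left s hM
      rw [pow_add, pow_mul, hrs, ← pow_mul, ← pow_add, Nat.add_sub_cancel' hle, hper']
    refine ⟨(r + (M * s - s)) % Function.minimalPeriod (fun x : Kˣ => x ^ p) γ, ?_, ?_⟩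
    · simpa using Nat.mod_lt _ (Function.minimalPeriod_pos_of_mem_periodicPts
        (MahlerTree.isPeriodicPt_of_mem_cycle h))
    · have := Function.iterate_mod_minimalPeriod_eq (f := fun x : Kˣ => x ^ p) (x := γ)
        (n := r + (M * s - s))
      simp only [pow_iterate] at this
      rw [hδγ]
      exact this
  · rintro ⟨j, -, rfl⟩
    exact MahlerTree.pow_pow_mem_cycle h j

theorem MahlerTree.cycleLength_eq {τ : MahlerTree K p} {γ : Kˣ} (h : γ ∈ τ.cycle) :
    τ.cycleLength = Function.minimalPeriod (fun x : Kˣ => x ^ p) γ := by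
  rw [MahlerTree.cycleLength, MahlerTree.cycle_eq_image h, Set.InjOn.ncard_image,
    Set.ncard_coe_finset, Finset.card_range]
  intro i hi j hj hij
  simp only [Finset.coe_range, Set.mem_Iio] at hi hj
  have hij' : (fun x : Kˣ => x ^ p)^[i] γ = (fun x : Kˣ => x ^ p)^[j] γ := by
    simpa only [pow_iterate] using hij
  exact Function.iterate_injOn_Iio_minimalPeriod hi hj hij'

theorem MahlerTree.cycleLength_pos {τ : MahlerTree K p} {γ : Kˣ} (h : γ ∈ τ.cycle) :
    0 < τ.cycleLength := by
  rw [MahlerTree.cycleLength_eq h]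
  exact Function.minimalPeriod_pos_of_mem_periodicPts (MahlerTree.isPeriodicPt_of_mem_cycle h)

theorem MahlerTree.pow_cycleLength {τ : MahlerTree K p} {γ : Kˣ} (h : γ ∈ τ.cycle) :
    γ ^ p ^ τ.cycleLength = γ := by
  have := Function.iterate_minimalPeriod (f := fun x : Kˣ => x ^ p) (x := γ)
  rw [pow_iterate] at this
  rw [MahlerTree.cycleLength_eq h]
  exact this

theorem MahlerTree.finite_cycle (τ : MahlerTree K p) : τ.cycle.Finite := by
  rcases τ.cycle.eq_empty_or_nonempty with h | ⟨γ, h⟩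
  · rw [h]
    exact Set.finite_empty
  · rw [MahlerTree.cycle_eq_image h]
    exact (Finset.finite_toSet _).image _

/-- For `λ = 0` the `0`-section is a section of the cycle map on the Mahler cycle. -/
theorem cycleMap_zeroSection [CharZero K] (hp : 2 ≤ p) {τ : MahlerTree K p} (m : ℕ)
    (c : ℕ → Kˣ → K) (k : ℕ) (hk : 1 ≤ k) (hkm : k ≤ m) {γ : Kˣ} (hγ : γ ∈ τ.cycle) :
    cycleMap p 0 m (zeroSection p 0 τ.cycleLength m c) k γ = c k γ := by
  set e := τ.cycleLength with he
  set d := zeroSection p 0 e m c with hd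
  have hp0 : (p : K) ≠ 0 := by
    have : p ≠ 0 := by omega
    exact_mod_cast this
  -- The equation in degree k, with the terms of higher degree moved to the right-hand side, is
  -- V^k_{k,1}(γ) d_k(γ^p) - d_k(γ) = b(γ).
  set b : Kˣ → K := fun δ => c k δ -
    ∑ s ∈ Finset.Icc (k + 1) m, mahlerCoeff p s k 1 δ * d s (δ ^ p) with hb
  set t : ℕ → K := fun j => (p : K) ^ (-(k * j : ℕ) : ℤ) * (γ : K) ^ (-((k * p ^ j : ℕ) : ℤ)) *
    b (γ ^ p ^ j) with ht
  have hform : ∀ δ : Kˣ, d k δ = (δ : K) ^ k / ((p : K) ^ (-(k * e : ℕ) : ℤ) - 1) *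
      ∑ j ∈ Finset.range e, (p : K) ^ (-(k * j : ℕ) : ℤ) *
        (δ : K) ^ (-((k * p ^ j : ℕ) : ℤ)) * b (δ ^ p ^ j) := by
    intro δ
    rw [hd, zeroSection, if_neg (by omega)]
    dsimp only
    -- The resonant case k = λ is impossible, as λ = 0 and k ≥ 1.
    rw [if_neg (by omega)]
    congr 1
    · congr 3
      push_cast
      ring
    · refine Finset.sum_congr rfl fun j _ => ?_
      congr 1
      · congr 2
        push_cast
        ring
      · rw [hb]
        dsimp only
        rw [zpow_zero, one_mul, Finset.sum_attach (Finset.Icc (k + 1) m) fun s =>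
          mahlerCoeff p s k 1 (δ ^ p ^ j) * zeroSection p 0 e m c s (δ ^ p ^ (j + 1))]
        simp only [pow_succ p j, pow_mul, hd]
  have hγe : γ ^ p ^ e = γ := MahlerTree.pow_cycleLength hγ
  have hγe' : (γ : K) ^ p ^ e = γ := by exact_mod_cast congrArg Units.val hγe
  have hg0 : (γ : K) ≠ 0 := γ.ne_zero
  have hden : (p : K) ^ (-(k * e : ℕ) : ℤ) - 1 ≠ 0 := by
    have hke : k * e ≠ 0 := by
      have := MahlerTree.cycleLength_pos hγ
      positivity
    have h1 : p ^ (k * e) ≠ 1 := by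
      have := Nat.one_lt_pow hke (show 1 < p by omega)
      omega
    rw [sub_ne_zero, zpow_neg, zpow_natCast, Ne, inv_eq_one]
    exact_mod_cast h1
  -- The diagonal coefficient p^(-k) γ^(k-kp) shifts the summation index by one, so the difference
  -- with d_k(γ) telescopes.
  have hself : mahlerCoeff p k k 1 γ * d k (γ ^ p) =
      (γ : K) ^ k / ((p : K) ^ (-(k * e : ℕ) : ℤ) - 1) * ∑ j ∈ Finset.range e, t (j + 1) := by
    rw [hform, mahlerCoeff_eq p k k 1 hp le_rfl, univMahlerCoeff_self, Finset.mul_sum,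
      Finset.mul_sum, Finset.mul_sum]
    refine Finset.sum_congr rfl fun j _ => ?_
    rw [ht]
    dsimp only
    have e1 : (γ ^ p) ^ p ^ j = γ ^ p ^ (j + 1) := by rw [← pow_mul, pow_succ']
    have e2 : (((γ ^ p : Kˣ) : K)) ^ (-((k * p ^ j : ℕ) : ℤ)) =
        (γ : K) ^ (-((k * p ^ (j + 1) : ℕ) : ℤ)) := by
      rw [Units.val_pow_eq_pow_val, ← zpow_natCast (γ : K) p, ← zpow_mul]
      congr 1
      push_cast
      ring
    have e3 : (p : K) ^ (-(k * (j + 1) : ℕ) : ℤ) =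
        (p : K) ^ (-(k * j : ℕ) : ℤ) * ((p : K) ^ k)⁻¹ := by
      rw [← zpow_natCast (p : K) k, ← zpow_neg, ← zpow_add₀ hp0]
      congr 1
      push_cast
      ring
    have e4 : (γ : K) ^ ((k : ℤ) - ((k * p ^ 1 : ℕ) : ℤ)) * ((γ ^ p : Kˣ) : K) ^ k =
        (γ : K) ^ k := by
      rw [Units.val_pow_eq_pow_val, ← pow_mul, ← zpow_natCast, ← zpow_natCast,
        ← zpow_add₀ hg0]
      congr 1
      push_cast
      ring
    rw [e1, e2, e3]
    push_cast
    rw [one_mul]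
    push_cast at e4
    generalize (γ : K) ^ (-((k : ℤ) * (p : ℤ) ^ (j + 1))) = y
    rw [← e4]
    ring
  have htel : (∑ j ∈ Finset.range e, t (j + 1)) - ∑ j ∈ Finset.range e, t j = t e - t 0 := by
    rw [← Finset.sum_sub_distrib, Finset.sum_range_sub]
  -- Going once around the cycle multiplies t by p^(-ke), so t e - t 0 cancels the denominator
  -- p^(-ke) - 1.
  have hte : t e = (p : K) ^ (-(k * e : ℕ) : ℤ) * ((γ : K) ^ k)⁻¹ * b γ := by
    rw [ht]
    dsimp only
    rw [hγe, zpow_neg (γ : K), zpow_natCast, mul_comm k (p ^ e), pow_mul, hγe']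
  have ht0 : t 0 = ((γ : K) ^ k)⁻¹ * b γ := by
    simp [ht]
  have hsum : ∑ s ∈ Finset.Icc k m, mahlerCoeff p s k 1 γ * d s (γ ^ p) =
      mahlerCoeff p k k 1 γ * d k (γ ^ p) +
        ∑ s ∈ Finset.Icc (k + 1) m, mahlerCoeff p s k 1 γ * d s (γ ^ p) := by
    rw [← Finset.add_sum_Ioc_eq_sum_Icc hkm, Finset.Icc_add_one_left_eq_Ioc]
  have hdt : d k γ = (γ : K) ^ k / ((p : K) ^ (-(k * e : ℕ) : ℤ) - 1) *
      ∑ j ∈ Finset.range e, t j := hform γ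
  have hmain : mahlerCoeff p k k 1 γ * d k (γ ^ p) - d k γ = b γ := by
    rw [hself, hdt, ← mul_sub, htel, hte, ht0]
    field_simp
  rw [cycleMap, zpow_zero, one_mul, hsum]
  rw [hb] at hmain
  dsimp only at hmain
  linear_combination hmain

/-! ### Inverting the truncated cycle map -/

/-- The truncated map has the sign opposite to that of the cycle map, so minus the 0-section is a
preimage of c. -/
theorem truncCycleMap_neg_zeroSection [CharZero K] (hp : 2 ≤ p) (τ : MahlerTree K p) (m : ℕ)
    (c : ℕ → Kˣ → K) :
    truncCycleMap τ m (fun k γ => -zeroSection p 0 τ.cycleLength m c k γ) =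
      fun (k : Finset.Icc 1 m) (γ : τ.cycle) => c k γ := by
  ext k γ
  obtain ⟨k, hk⟩ := k
  obtain ⟨hk1, hkm⟩ := Finset.mem_Icc.mp hk
  have h := cycleMap_zeroSection hp m c k hk1 hkm γ.2
  rw [cycleMap, zpow_zero, one_mul] at h
  rw [← h]
  simp only [truncCycleMap, LinearMap.coe_mk, AddHom.coe_mk, mul_neg, Finset.sum_neg_distrib, sub_neg_eq_add]
  congr 1
  refine Finset.sum_bij' (fun s _ => s.1)
    (fun s hs => ⟨s, Finset.mem_Icc.mpr ⟨hk1.trans (Finset.mem_Icc.mp hs).1,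
      (Finset.mem_Icc.mp hs).2⟩⟩) ?_ ?_ ?_ ?_ ?_
  · intro s hs
    exact Finset.mem_Icc.mpr ⟨(Finset.mem_filter.mp hs).2, (Finset.mem_Icc.mp s.2).2⟩
  · intro s hs
    exact Finset.mem_filter.mpr ⟨Finset.mem_univ _, (Finset.mem_Icc.mp hs).1⟩
  · intros; rfl
  · intros; rfl
  · intros; rfl

/-- The 0-section shows surjectivity; the cycle is finite, so the space is finite-dimensional and
injectivity follows. -/
theorem truncCycleMap_injective [CharZero K] (hp : 2 ≤ p) (τ : MahlerTree K p) (m : ℕ) :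
    Function.Injective (truncCycleMap τ m) := by
  classical
  have := τ.finite_cycle.to_subtype
  rw [LinearMap.injective_iff_surjective]
  intro v
  refine ⟨_, (truncCycleMap_neg_zeroSection hp τ m fun k γ =>
    if h : k ∈ Finset.Icc 1 m ∧ γ ∈ τ.cycle then v ⟨k, h.1⟩ ⟨γ, h.2⟩ else 0).trans ?_⟩
  ext k γ
  rw [dif_pos ⟨k.2, γ.2⟩]

theorem auxVector_eq [CharZero K] (hp : 2 ≤ p) (f : RatFunc K) (τ : MahlerTree K p) (k : ℕ)
    (hk : k ∈ Finset.Icc 1 (treeOrder f τ)) {γ : Kˣ} (hγ : γ ∈ τ.cycle) :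
    auxVector f τ k γ = -zeroSection p 0 τ.cycleLength (treeOrder f τ) (coeffs f) k γ := by
  rw [auxVector, dif_pos ⟨hk, hγ⟩, auxMap,
    ← truncCycleMap_neg_zeroSection hp τ (treeOrder f τ) (coeffs f),
    Function.leftInverse_invFun (truncCycleMap_injective hp τ _)]

/-! ### Comparison of the two families of residues -/

/-- Base vector and coefficient vector coincide, so the base term of the closed form is the missing
summand n = h. -/
theorem nonTorsionRes_zero_eq [CharZero K] (hp : 2 ≤ p) (f : RatFunc K) (τ : MahlerTree K p)
    (k : ℕ) (α : Kˣ) : recNonTorsionRes f τ k α = nonTorsionRes 0 f τ k α := by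
  rw [recNonTorsionRes, nonTorsionRes]
  split_ifs with h1 h2
  · rfl
  · rw [pushUp_eq p _ hp _ _ _ _ (by omega)]
    simp only [zero_mul, zpow_zero, one_mul, Finset.sum_range_succ]
  · rfl

theorem torsionRes_zero_eq [CharZero K] (hp : 2 ≤ p) (f : RatFunc K) (τ : MahlerTree K p)
    (k : ℕ) (hk : 1 ≤ k) (α : Kˣ) : recTorsionRes f τ k α = torsionRes 0 f τ k α := by
  rw [recTorsionRes, torsionRes]
  set h := torsionHeight f τ with hh
  set m := treeOrder f τ with hm
  set e := τ.cycleLength with he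
  by_cases h1 : ¬ InSupp f τ ∨ m < k
  · simp [h1]
  rw [if_neg h1, if_neg h1]
  by_cases h0 : h = 0
  · simp [h0]
  rw [if_neg h0, if_neg h0]
  by_cases h2 : torsionEta τ α = h
  swap
  · rw [if_neg h2, if_neg h2, if_neg (by omega)]
  rw [if_pos h2, if_pos h2]
  -- An infimum over the empty set would be 0; as h ≠ 0, the height is attained.
  have hcyc : α ^ p ^ h ∈ τ.cycle := by
    rw [← h2]
    exact Nat.sInf_mem (s := {n | α ^ p ^ n ∈ τ.cycle})
      (Nat.nonempty_of_pos_sInf (Nat.pos_of_ne_zero (h2.trans_ne h0)))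
  -- For λ = 0 the residual average plays no role.
  have hd : omegaSection p 0 e m (residualAverage 0 f τ) (coeffs f) =
      zeroSection p 0 e m (coeffs f) := by
    funext k γ
    rw [omegaSection, if_pos le_rfl]
  rw [hd, pushUp_eq p m hp _ _ _ _ (by omega)]
  simp only [zero_mul, zpow_zero, one_mul, Finset.sum_add_distrib]
  rw [sub_eq_add_neg]
  congr 1
  set d := zeroSection p 0 e m (coeffs f) with hdd
  obtain ⟨r, hr⟩ : ∃ r, h = r + 1 := ⟨h - 1, by omega⟩
  have he1 : (α ^ p ^ (h + e - 1)) ^ p = α ^ p ^ h := by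
    rw [← pow_mul, ← pow_succ, show h + e - 1 + 1 = h + e by omega, pow_add, pow_mul,
      MahlerTree.pow_cycleLength hcyc]
  have he2 : (α : K) ^ p ^ (h + e) = (α : K) ^ p ^ h := by
    have := congrArg Units.val (MahlerTree.pow_cycleLength hcyc)
    rw [← pow_mul, ← pow_add] at this
    exact_mod_cast this
  have hα : (α : K) ≠ 0 := α.ne_zero
  have hcd : ∀ s γ, cycleMap p 0 m d s γ + d s γ =
      ∑ j ∈ Finset.Icc s m, mahlerCoeff p j s 1 γ * d j (γ ^ p) := by
    intro s γ
    rw [cycleMap, zpow_zero]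
    ring
  simp only [hcd, he1]
  -- The composition law for h = 1 + (h-1): the factor with h-1 steps belongs to α, the single step
  -- to α^(p^(h+e-1)).
  have hL : ∀ s ∈ Finset.Icc k m, mahlerCoeff p s k h α * auxVector f τ s (α ^ p ^ h) =
      -∑ j ∈ Finset.Icc k s, (univMahlerCoeff p j k (h - 1) : K) *
        (α : K) ^ ((k : ℤ) - ((j * p ^ (h + e - 1) : ℕ) : ℤ)) *
        (mahlerCoeff p s j 1 (α ^ p ^ (h + e - 1)) * d s (α ^ p ^ h)) := by
    intro s hs
    obtain ⟨hks, hsm⟩ := Finset.mem_Icc.mp hs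
    rw [auxVector_eq hp f τ s (Finset.mem_Icc.mpr ⟨hk.trans hks, hsm⟩) hcyc,
      mahlerCoeff_eq p s k h hp hks, show h = 1 + (h - 1) by omega,
      univMahlerCoeff_add p s k 1 (h - 1) hp hks, ← show h = 1 + (h - 1) by omega, mul_neg,
      neg_inj, Rat.cast_sum, Finset.sum_mul, Finset.sum_mul]
    refine Finset.sum_congr rfl fun j hj => ?_
    obtain ⟨hkj, hjs⟩ := Finset.mem_Icc.mp hj
    rw [mahlerCoeff_eq p s j 1 hp hjs]
    -- Once p^h is replaced by p^(h+e), which does not change the power of α, the terms in j cancel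
    -- in the exponent.
    have hz : (α : K) ^ ((k : ℤ) - ((s * p ^ h : ℕ) : ℤ)) =
        (α : K) ^ ((k : ℤ) - ((j * p ^ (h + e - 1) : ℕ) : ℤ)) *
          ((α ^ p ^ (h + e - 1) : Kˣ) : K) ^ ((j : ℤ) - ((s * p ^ 1 : ℕ) : ℤ)) := by
      have : (α : K) ^ ((k : ℤ) - ((s * p ^ h : ℕ) : ℤ)) =
          (α : K) ^ ((k : ℤ) - ((s * p ^ (h + e) : ℕ) : ℤ)) := by
        rw [zpow_sub₀ hα, zpow_sub₀ hα, zpow_natCast _ (s * p ^ h),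
          zpow_natCast _ (s * p ^ (h + e)), mul_comm s, mul_comm s, pow_mul, pow_mul, he2]
      rw [this, Units.val_pow_eq_pow_val, ← zpow_natCast (α : K) (p ^ (h + e - 1)), ← zpow_mul,
        ← zpow_add₀ hα]
      congr 1
      rw [show h + e = h + e - 1 + 1 by omega]
      push_cast
      ring
    rw [hz]
    push_cast
    ring
  rw [Finset.sum_congr rfl hL, Finset.sum_neg_distrib, neg_inj]
  simp only [Finset.mul_sum]
  rw [Finset.sum_sigma', Finset.sum_sigma']
  refine Finset.sum_bij' (fun x _ => ⟨x.2, x.1⟩) (fun x _ => ⟨x.2, x.1⟩) ?_ ?_ ?_ ?_ ?_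
  · rintro ⟨a, b⟩ h
    simp only [Finset.mem_sigma, Finset.mem_Icc] at *
    omega
  · rintro ⟨a, b⟩ h
    simp only [Finset.mem_sigma, Finset.mem_Icc] at *
    omega
  · intros; rfl
  · intros; rfl
  · intros; rfl

end Mahler
end

theorem proposition5p18 {K : Type*} [Field K] [IsAlgClosed K] [CharZero K] (p : ℕ) (hp : 2 ≤ p)
    (f : RatFunc K) (τ : Mahler.MahlerTree K p) (k : ℕ) (hk : 1 ≤ k) :
    Mahler.recursiveRes f τ k = Mahler.twistedRes 0 f τ k := by
  funext α
  rw [Mahler.recursiveRes, Mahler.twistedRes, Mahler.nonTorsionRes_zero_eq hp,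
    Mahler.torsionRes_zero_eq hp f τ k hk]
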